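/- Let $n,m\in\mathbb N$, let $J,R,Q\in\mathbb R^{n\times n}$ with $J$ skew-symmetric, $R$ symmetric positive semidefinite and $Q$ symmetric positive definite, let $B\in\mathbb R^{n\times m}$ have full rank $m\le n$, and let $\mathbb U=[\underline u_1,\overline u_1]\times\dots\times[\underline u_m,\overline u_m]$ contain $0$ in its interior. For $T\ge 0$ and $x^0,x_T\in\mathbb R^n$ consider the optimal control problem $$\min_{u\in L^1(0,T;\mathbb U)}\int_0^T u(t)^\top y(t)\,dt\quad\text{s.t.}\quad \dot x(t)=(J-R)Qx(t)+Bu(t),\ \ y(t)=B^\top Qx(t),\ \ x(0)=x^0,\ x(T)=x_T,$$ where states $x\in W^{1,1}(0,T;\mathbb R^n)$ are absolutely continuous and solve the differential equation almost everywhere. Let $\mathcal V=\ker(R^{1/2}Q)$ and $\operatorname{dist}(x,\mathcal V)=\inf_{v\in\mathcal V}\|v-x\|$ (Euclidean norm). Then: 1. (Strict dissipativity with respect to $\mathcal V$.) There are a function $S:\mathbb R^n\to[0,\infty)$ and a continuous, strictly increasing function $\alpha:[0,\infty)\to[0,\infty)$ with $\alpha(0)=0$ such that, for all $T\ge 0$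 and $x^0,x_T\in\mathbb R^n$, every optimal control $u^\star$ with associated state $x^\star$ satisfies $$S(x_T)-S(x^0)\le\int_0^T u^\star(t)^\top B^\top Qx^\star(t)-\alpha\big(\operatorname{dist}(x^\star(t),\mathcal V)\big)\,dt .$$ 2. (Subspace turnpike property.) Suppose in addition that the system is controllable, i.e. $\operatorname{rank}(B,AB,\dots,A^{n-1}B)=n$ for $A=(J-R)Q$, and let $x_T\in\mathbb R^n$ be reachable from $0$, i.e. some control $u\in L^1(0,T_2;\mathbb U)$, $T_2\ge 0$, steers $0$ to $x_T$ at time $T_2$. Then for every compact $K\subset\mathbb R^n$ and every $\varepsilon>0$ there is $C_{K,\varepsilon}>0$ such that, for all $T\ge 0$ and $x^0\in K$, every optimal state $x^\star$ of the problem with horizon $T$, initial state $x^0$ and terminal state $x_T$ satisfies $$\mu\big(\{t\in[0,T]:\operatorname{dist}(x^\star(t),\mathcal V)\ge\varepsilon\}\big)<C_{K,\varepsilon},$$ where $\mu$ is the Lebesgue measure. -/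

import Mathlib

open MeasureTheory Set
open scoped Matrix MatrixOrder

noncomputable section

namespace PortHam

/-- The set of control values: the box `[lo 1, hi 1] × ⋯ × [lo m, hi m]`. -/
def controlBox {m : ℕ} (lo hi : Fin m → ℝ) : Set (EuclideanSpace ℝ (Fin m)) :=
  {v | ∀ i, lo i ≤ v i ∧ v i ≤ hi i}

/-- `u ∈ L¹(0,T;U)`: `u` is (Lebesgue) measurable and integrable on `[0,T]`, with values in `U`
almost everywhere. -/
def IsControl {m : ℕ} (U : Set (EuclideanSpace ℝ (Fin m))) (T : ℝ)
    (u : ℝ → EuclideanSpace ℝ (Fin m)) : Prop :=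
  IntegrableOn u (Icc 0 T) ∧ ∀ᵐ t ∂(volume.restrict (Icc 0 T)), u t ∈ U

/-- `x` is a state trajectory on `[0,T]` of `ẋ = A x + B u`: it is (the continuous representative
of) a `W^{1,1}` function, i.e. absolutely continuous, and solves the equation a.e. -/
def IsTrajectory {n m : ℕ} (A : Matrix (Fin n) (Fin n) ℝ) (B : Matrix (Fin n) (Fin m) ℝ) (T : ℝ)
    (u : ℝ → EuclideanSpace ℝ (Fin m)) (x : ℝ → EuclideanSpace ℝ (Fin n)) : Prop :=
  AbsolutelyContinuousOnInterval x 0 T ∧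
    ∀ᵐ t ∂(volume.restrict (Icc 0 T)),
      HasDerivAt x (A.toEuclideanLin (x t) + B.toEuclideanLin (u t)) t

/-- The data of a linear optimal control problem: dynamics `ẋ = A x + B u`, control values in `U`,
running cost `ℓ`.  The horizon and the two endpoints are separate arguments below. -/
structure LinearOCP (n m : ℕ) where
  /-- system matrix -/
  A : Matrix (Fin n) (Fin n) ℝ
  /-- input matrix -/
  B : Matrix (Fin n) (Fin m) ℝ
  /-- set of control values -/
  U : Set (EuclideanSpace ℝ (Fin m))
  /-- running cost -/
  ℓ : EuclideanSpace ℝ (Fin n) → EuclideanSpace ℝ (Fin m) → ℝ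

namespace LinearOCP

variable {n m : ℕ} (P : LinearOCP n m)

/-- The control `u` steers `x₀` to `xT` in time `T`, along the trajectory `x`. -/
def IsFeasible (T : ℝ) (x₀ xT : EuclideanSpace ℝ (Fin n))
    (x : ℝ → EuclideanSpace ℝ (Fin n)) (u : ℝ → EuclideanSpace ℝ (Fin m)) : Prop :=
  IsControl P.U T u ∧ IsTrajectory P.A P.B T u x ∧ x 0 = x₀ ∧ x T = xT

/-- The running cost along `(x,u)` is integrable, so that the cost is well defined. -/
def HasCost (T : ℝ) (x : ℝ → EuclideanSpace ℝ (Fin n))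
    (u : ℝ → EuclideanSpace ℝ (Fin m)) : Prop :=
  IntervalIntegrable (fun t => P.ℓ (x t) (u t)) volume 0 T

/-- The cost `∫₀ᵀ ℓ(x(t),u(t)) dt`. -/
def cost (T : ℝ) (x : ℝ → EuclideanSpace ℝ (Fin n))
    (u : ℝ → EuclideanSpace ℝ (Fin m)) : ℝ :=
  ∫ t in (0 : ℝ)..T, P.ℓ (x t) (u t)

/-- `u` is an optimal control, with optimal state `x`, for the problem on `[0,T]` with endpoints
`x₀` and `xT`. -/
def IsOptimal (T : ℝ) (x₀ xT : EuclideanSpace ℝ (Fin n))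
    (x : ℝ → EuclideanSpace ℝ (Fin n)) (u : ℝ → EuclideanSpace ℝ (Fin m)) : Prop :=
  P.IsFeasible T x₀ xT x u ∧ P.HasCost T x u ∧
    ∀ x' u', P.IsFeasible T x₀ xT x' u' → P.HasCost T x' u' → P.cost T x u ≤ P.cost T x' u'

/-- `xT` is reachable from `x₀` in some finite time, with controls taking values in `U`. -/
def Reachable (x₀ xT : EuclideanSpace ℝ (Fin n)) : Prop :=
  ∃ T : ℝ, 0 ≤ T ∧ ∃ x u, P.IsFeasible T x₀ xT x u

end LinearOCP

/-- Functions of class `𝒦`: `α : [0,∞) → [0,∞)` continuous, strictly increasing, `α 0 = 0`. -/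
def IsClassK (α : ℝ → ℝ) : Prop :=
  ContinuousOn α (Ici 0) ∧ StrictMonoOn α (Ici 0) ∧ α 0 = 0

namespace LinearOCP

variable {n m : ℕ} (P : LinearOCP n m)

/-- Strict dissipativity with respect to the subspace `V`: there are a nonnegative storage function
`S` and `α ∈ 𝒦` such that, for all horizons and all endpoints, every optimal pair satisfies
`S(xT) - S(x₀) ≤ ∫₀ᵀ ℓ(x(t),u(t)) - α(dist(x(t),V)) dt`. -/
def StrictlyDissipative (V : Submodule ℝ (EuclideanSpace ℝ (Fin n))) : Prop :=
  ∃ (S : EuclideanSpace ℝ (Fin n) → ℝ) (α : ℝ → ℝ), (∀ z, 0 ≤ S z) ∧ IsClassK α ∧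
    ∀ (T : ℝ) (x₀ xT : EuclideanSpace ℝ (Fin n)) x u, 0 ≤ T → P.IsOptimal T x₀ xT x u →
      IntervalIntegrable
        (fun t => P.ℓ (x t) (u t) - α (Metric.infDist (x t) (V : Set _))) volume 0 T ∧
      S xT - S x₀ ≤ ∫ t in (0 : ℝ)..T, (P.ℓ (x t) (u t) - α (Metric.infDist (x t) (V : Set _)))

/-- The subspace turnpike property with respect to `V`, for the terminal state `xT`: for every
compact set `K` of initial states and every `ε > 0`, the time that optimal trajectories starting in
`K` spend at distance at least `ε` from `V` is bounded independently of the horizon. -/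
def SubspaceTurnpike (xT : EuclideanSpace ℝ (Fin n))
    (V : Submodule ℝ (EuclideanSpace ℝ (Fin n))) : Prop :=
  ∀ K : Set (EuclideanSpace ℝ (Fin n)), IsCompact K → ∀ ε : ℝ, 0 < ε →
    ∃ C : ℝ, 0 < C ∧ ∀ (T : ℝ) x₀ x u, 0 ≤ T → x₀ ∈ K → P.IsOptimal T x₀ xT x u →
      volume {t : ℝ | t ∈ Icc 0 T ∧ ε ≤ Metric.infDist (x t) (V : Set _)} < ENNReal.ofReal C

end LinearOCP

/-- The Kalman matrix `(B, A B, …, A^{n-1} B)`. -/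
def kalmanMatrix {n m : ℕ} (A : Matrix (Fin n) (Fin n) ℝ) (B : Matrix (Fin n) (Fin m) ℝ) :
    Matrix (Fin n) (Fin n × Fin m) ℝ :=
  Matrix.of fun i p => (A ^ (p.1 : ℕ) * B) i p.2

/-- Controllability of `(A,B)`: the Kalman matrix has full rank. -/
def Controllable {n m : ℕ} (A : Matrix (Fin n) (Fin n) ℝ) (B : Matrix (Fin n) (Fin m) ℝ) : Prop :=
  (kalmanMatrix A B).rank = n

/-- The minimal energy supply problem of the port-Hamiltonian system
`ẋ = (J - R) Q x + B u`, `y = Bᵀ Q x`, with running cost `uᵀ y` and box constraints. -/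
def energySupplyOCP {n m : ℕ} (J R Q : Matrix (Fin n) (Fin n) ℝ) (B : Matrix (Fin n) (Fin m) ℝ)
    (lo hi : Fin m → ℝ) : LinearOCP n m where
  A := (J - R) * Q
  B := B
  U := controlBox lo hi
  ℓ := fun x u => inner ℝ u ((Bᵀ * Q).toEuclideanLin x)

/-- The subspace `ker (R^{1/2} Q)`, where `R^{1/2}` is the positive semidefinite square root. -/
def dissipationKernel {n : ℕ} (R Q : Matrix (Fin n) (Fin n) ℝ) :
    Submodule ℝ (EuclideanSpace ℝ (Fin n)) :=
  LinearMap.ker (CFC.sqrt R * Q).toEuclideanLin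

end PortHam

end

open PortHam

/-!
For a port-Hamiltonian system the energy `H x = ½ xᵀ Q x` satisfies, along every trajectory,
`H (x T) - H (x 0) = ∫ uᵀ y - ‖R^{1/2} Q x‖²` (`energy_balance`).  A linear map is bounded below by
a multiple of the distance to its kernel (`LinearMap.exists_infDist_ker_le`), so that
`‖R^{1/2} Q x‖² ≥ α (dist (x, ker (R^{1/2} Q)))` with `α s = (s / K) ^ 2`.  This is strict
dissipativity, with storage function `H`; optimality plays no role.

For the turnpike property, the dissipation inequality bounds the integral of
`α (dist (x t, ker (R^{1/2} Q)))` by the optimal cost plus `H (x 0)`, and Chebyshev's inequality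
turns this into a bound on the time spent away from the kernel.  So it suffices to bound the optimal
cost uniformly over long horizons and over a compact set of initial states
(`exists_steers_of_reachable`).  The competitor is steered to `0`, rests there at no cost, and is
then steered to the target as the reachability assumption allows.

The substance is the first phase, null controllability with bounded controls in a time that is
uniform over bounded sets (`LinearOCP.exists_steers_zero`).  The free motion does not increase the
energy, hence `e^{tA}` is bounded for `t ≥ 0`.  By controllability the Gramian is invertible and
yields controls that steer `0` to any `b` in unit time and depend linearly on `b`
(`exists_unit_time_steering`).  Superposing these on the free motion, one can pass through the
points `(1 - k / N) e^{kA} a` at the times `k = 0, …, N`; the corrections, and with them the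
controls, are of size `O(1 / N)`, so they are admissible once `N` is large.
-/

/-! ### Absolutely continuous functions -/

/-- Absolute continuity is preserved under a monotone contraction of the time axis: it maps
disjoint intervals to disjoint intervals and does not increase their total length. -/
theorem AbsolutelyContinuousOnInterval.comp_monotone {X : Type*} [PseudoMetricSpace X]
    {f : ℝ → X} {g : ℝ → ℝ} {a b c d : ℝ} (hf : AbsolutelyContinuousOnInterval f c d)
    (hg : Monotone g) (hL : LipschitzWith 1 g) (hmaps : MapsTo g (uIcc a b) (uIcc c d)) :
    AbsolutelyContinuousOnInterval (fun t => f (g t)) a b := by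
  rw [absolutelyContinuousOnInterval_iff] at hf ⊢
  intro ε hε
  obtain ⟨δ, hδ, h⟩ := hf ε hε
  refine ⟨δ, hδ, fun E hE hlen => ?_⟩
  refine h (E.1, fun i => (g (E.2 i).1, g (E.2 i).2)) ⟨fun i hi => ?_, fun i hi j hj hij => ?_⟩ ?_
  · exact ⟨hmaps (hE.1 i hi).1, hmaps (hE.1 i hi).2⟩
  · have hdisj := Set.disjoint_left.1 (hE.2 hi hj hij)
    refine Set.disjoint_left.2 fun y hy hy' => ?_
    simp only [mem_uIoc] at hy hy' hdisj
    have key : ∀ p q : ℝ, g p < g q → p < q := fun p q hpq => hg.reflect_lt hpq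
    -- if two images meet, then the smaller of the right endpoints lies in both intervals
    have d1 := @hdisj (E.2 i).1
    have d2 := @hdisj (E.2 i).2
    have d3 := @hdisj (E.2 j).1
    have d4 := @hdisj (E.2 j).2
    rcases hy with ⟨h1, h2⟩ | ⟨h1, h2⟩ <;> rcases hy' with ⟨h3, h4⟩ | ⟨h3, h4⟩
    · have := key _ _ (h1.trans_le h2); have := key _ _ (h3.trans_le h4)
      have := key _ _ (h1.trans_le h4); have := key _ _ (h3.trans_le h2)
      rcases le_total (E.2 i).2 (E.2 j).2 <;> grind
    · have := key _ _ (h1.trans_le h2); have := key _ _ (h3.trans_le h4)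
      have := key _ _ (h1.trans_le h4); have := key _ _ (h3.trans_le h2)
      rcases le_total (E.2 i).2 (E.2 j).1 <;> grind
    · have := key _ _ (h1.trans_le h2); have := key _ _ (h3.trans_le h4)
      have := key _ _ (h1.trans_le h4); have := key _ _ (h3.trans_le h2)
      rcases le_total (E.2 i).1 (E.2 j).2 <;> grind
    · have := key _ _ (h1.trans_le h2); have := key _ _ (h3.trans_le h4)
      have := key _ _ (h1.trans_le h4); have := key _ _ (h3.trans_le h2)
      rcases le_total (E.2 i).1 (E.2 j).1 <;> grind
  · refine lt_of_le_of_lt (Finset.sum_le_sum fun i _ => ?_) hlen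
    simpa using hL.dist_le_mul (E.2 i).1 (E.2 i).2

theorem LipschitzOnWith.comp_absolutelyContinuousOnInterval {X Y : Type*} [PseudoMetricSpace X]
    [PseudoMetricSpace Y] {φ : X → Y} {f : ℝ → X} {s : Set X} {K : NNReal} {a b : ℝ}
    (hφ : LipschitzOnWith K φ s) (hf : AbsolutelyContinuousOnInterval f a b)
    (hmaps : MapsTo f (uIcc a b) s) : AbsolutelyContinuousOnInterval (fun t => φ (f t)) a b := by
  rw [absolutelyContinuousOnInterval_iff] at hf ⊢
  intro ε hε
  have hK : 0 < (K : ℝ) + 1 := by positivity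
  obtain ⟨δ, hδ, h⟩ := hf (ε / (K + 1)) (by positivity)
  refine ⟨δ, hδ, fun E hE hlen => ?_⟩
  have h1 := h E hE hlen
  rw [lt_div_iff₀' hK, Finset.mul_sum] at h1
  refine lt_of_le_of_lt (Finset.sum_le_sum fun i hi => ?_) h1
  have h2 := hφ.dist_le_mul _ (hmaps (hE.1 i hi).1) _ (hmaps (hE.1 i hi).2)
  have h3 : 0 ≤ dist (f (E.2 i).1) (f (E.2 i).2) := dist_nonneg
  linarith

/-- Composing an absolutely continuous curve with a `C¹` function, which is Lipschitz on the
bounded range of the curve, gives an absolutely continuous curve. -/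
theorem ContDiff.comp_absolutelyContinuousOnInterval {E F : Type*} [NormedAddCommGroup E]
    [NormedSpace ℝ E] [FiniteDimensional ℝ E] [NormedAddCommGroup F] [NormedSpace ℝ F]
    {φ : E → F} (hφ : ContDiff ℝ 1 φ) {f : ℝ → E} {a b : ℝ}
    (hf : AbsolutelyContinuousOnInterval f a b) :
    AbsolutelyContinuousOnInterval (fun t => φ (f t)) a b := by
  obtain ⟨C, hC⟩ := hf.exists_bound
  obtain ⟨K, hK⟩ := hφ.contDiffOn.exists_lipschitzOnWith (s := Metric.closedBall (0 : E) C)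
    one_ne_zero (convex_closedBall _ _) (isCompact_closedBall _ _)
  exact hK.comp_absolutelyContinuousOnInterval hf fun t ht => by simpa using hC t ht

/-! ### The distance to the kernel of a linear map -/

/-- In finite dimension, a linear map is bounded below by the distance to its kernel, because it
is injective on the orthogonal complement of the kernel. -/
theorem LinearMap.exists_infDist_ker_le {E F : Type*} [NormedAddCommGroup E]
    [InnerProductSpace ℝ E] [FiniteDimensional ℝ E] [NormedAddCommGroup F] [NormedSpace ℝ F]
    (f : E →ₗ[ℝ] F) :
    ∃ K : ℝ, 0 < K ∧ ∀ x, Metric.infDist x (LinearMap.ker f : Set E) ≤ K * ‖f x‖ := by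
  obtain ⟨K, hK, hanti⟩ := (f.domRestrict (LinearMap.ker f)ᗮ).exists_antilipschitzWith (by
    rw [LinearMap.ker_eq_bot']
    rintro ⟨w, hw⟩ hfw
    exact Subtype.ext
      ((LinearMap.ker f).inner_right_of_mem_orthogonal (u := w) (by simpa using hfw) hw |>
        inner_self_eq_zero.1))
  refine ⟨K, hK, fun x => ?_⟩
  obtain ⟨y, hy, z, hz, rfl⟩ := (LinearMap.ker f).exists_add_mem_mem_orthogonal x
  have h1 := hanti.le_mul_dist ⟨z, hz⟩ 0
  have h2 : f (y + z) = f z := by rw [map_add, LinearMap.mem_ker.1 hy, zero_add]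
  calc Metric.infDist (y + z) (LinearMap.ker f : Set E) ≤ dist (y + z) y :=
        Metric.infDist_le_dist_of_mem hy
    _ = ‖z‖ := by simp [dist_eq_norm]
    _ ≤ K * ‖f (y + z)‖ := by simpa [h2, dist_eq_norm] using h1

/-! ### Steering a controllable linear system in unit time -/

theorem exp_zero_smul_apply {E : Type*} [NormedAddCommGroup E] [NormedSpace ℝ E]
    (A : E →L[ℝ] E) (v : E) : NormedSpace.exp ((0 : ℝ) • A) v = v := by
  simp

section Steering

variable {E F : Type*} [NormedAddCommGroup E] [InnerProductSpace ℝ E] [FiniteDimensional ℝ E]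
  [NormedAddCommGroup F] [InnerProductSpace ℝ F]

theorem hasDerivAt_exp_smul_apply (A : E →L[ℝ] E) (v : E) (t : ℝ) :
    HasDerivAt (fun s : ℝ => NormedSpace.exp (s • A) v) (A (NormedSpace.exp (t • A) v)) t := by
  simpa using (hasDerivAt_exp_smul_const' A t).clm_apply (hasDerivAt_const t v)

theorem continuous_exp_smul (A : E →L[ℝ] E) : Continuous fun s : ℝ => NormedSpace.exp (s • A) :=
  continuous_iff_continuousAt.2 fun t => (hasDerivAt_exp_smul_const A t).continuousAt

theorem exp_add_smul_apply (A : E →L[ℝ] E) (s t : ℝ) (v : E) :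
    NormedSpace.exp ((s + t) • A) v = NormedSpace.exp (s • A) (NormedSpace.exp (t • A) v) := by
  let _ : NormedAlgebra ℚ (E →L[ℝ] E) := NormedAlgebra.restrictScalars ℚ ℝ _
  rw [add_smul, NormedSpace.exp_add_of_commute (((Commute.refl A).smul_left _).smul_right _)]
  rfl

theorem exp_smul_comp_exp_smul_neg (A : E →L[ℝ] E) (t : ℝ) :
    NormedSpace.exp (t • A) ∘L NormedSpace.exp (t • (-A)) = ContinuousLinearMap.id ℝ E := by
  ext v
  have h := exp_add_smul_apply A t (-t) v
  rw [add_neg_cancel, exp_zero_smul_apply, neg_smul, ← smul_neg] at h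
  exact h.symm

/-- If `v` is orthogonal to `e^{-sA} B w` for all `w` and all `s ∈ (0,1)`, then, differentiating at
`s = 1/2`, `(e^{-A/2})† v` is orthogonal to all `A ^ k B w`; so `v = 0` for a controllable pair. -/
theorem eq_zero_of_inner_exp_smul_eq_zero (A : E →L[ℝ] E) (B : F →L[ℝ] E)
    (hctrl : ∀ v : E, (∀ (k : ℕ) (w : F), inner ℝ v ((A ^ k) (B w)) = 0) → v = 0) {v : E}
    (hv : ∀ s ∈ Ioo (0 : ℝ) 1, ∀ w, inner ℝ v (NormedSpace.exp (s • (-A)) (B w)) = 0) :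
    v = 0 := by
  have key : ∀ k : ℕ, ∀ s ∈ Ioo (0 : ℝ) 1, ∀ w,
      inner ℝ v (NormedSpace.exp (s • (-A)) ((A ^ k) (B w))) = 0 := by
    intro k
    induction k with
    | zero => simpa using hv
    | succ k ih =>
      intro s hs w
      have h1 := (hasDerivAt_const s v).inner ℝ
        ((hasDerivAt_exp_smul_const (-A) s).clm_apply (hasDerivAt_const s ((A ^ k) (B w))))
      have h2 : HasDerivAt (fun s : ℝ => inner ℝ v (NormedSpace.exp (s • (-A)) ((A ^ k) (B w))))
          0 s := by
        refine (hasDerivAt_const s (0 : ℝ)).congr_of_eventuallyEq ?_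
        filter_upwards [Ioo_mem_nhds hs.1 hs.2] with r hr using ih r hr w
      have h3 := h1.unique h2
      simpa [pow_succ'] using h3
  set e := NormedSpace.exp ((1 / 2 : ℝ) • (-A)) with he
  have h0 : ContinuousLinearMap.adjoint e v = 0 := by
    refine hctrl _ fun k w => ?_
    rw [ContinuousLinearMap.adjoint_inner_left]
    exact key k _ (by norm_num) w
  have h1 := exp_smul_comp_exp_smul_neg (-A) (1 / 2)
  have h2 : v = e (NormedSpace.exp ((1 / 2 : ℝ) • (- -A)) v) := by
    have := congrArg (fun f : E →L[ℝ] E => f v) h1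
    exact this.symm
  rw [← inner_self_eq_zero (𝕜 := ℝ)]
  nth_rw 2 [h2]
  rw [← ContinuousLinearMap.adjoint_inner_left, h0, inner_zero_left]

/-- For a controllable pair `(A, B)` there is a linear choice `b ↦ U(·) b` of continuous controls
steering `0` to `b` in unit time, along `X(·) b`.  It is built from the inverse of the
controllability Gramian `∫₀¹ e^{-sA} B B† (e^{-sA})† ds`. -/
theorem exists_unit_time_steering [FiniteDimensional ℝ F] (A : E →L[ℝ] E) (B : F →L[ℝ] E)
    (hctrl : ∀ v : E, (∀ (k : ℕ) (w : F), inner ℝ v ((A ^ k) (B w)) = 0) → v = 0) :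
    ∃ (U : ℝ → E →L[ℝ] F) (X : ℝ → E →L[ℝ] E), Continuous U ∧ X 0 = 0 ∧
      X 1 = ContinuousLinearMap.id ℝ E ∧ ∀ t, HasDerivAt X (A ∘L X t + B ∘L U t) t := by
  set G : ℝ → F →L[ℝ] E := fun s => NormedSpace.exp (s • (-A)) ∘L B with hG
  have hGc : Continuous G := (continuous_exp_smul (-A)).clm_comp continuous_const
  set G' : ℝ → E →L[ℝ] F := fun s => ContinuousLinearMap.adjoint (G s) with hG'
  have hGc' : Continuous G' := ContinuousLinearMap.adjoint.continuous.comp hGc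
  have hGG : Continuous fun s => G s ∘L G' s := hGc.clm_comp hGc'
  set W : ℝ → E →L[ℝ] E := fun t => ∫ s in (0 : ℝ)..t, G s ∘L G' s with hW
  have hWd : ∀ t, HasDerivAt W (G t ∘L G' t) t := fun t =>
    (hGG.integral_hasStrictDerivAt 0 t).hasDerivAt
  -- the Gramian is positive definite
  have hWinj : LinearMap.ker (W 1 : E →ₗ[ℝ] E) = ⊥ := by
    rw [LinearMap.ker_eq_bot']
    intro v hv
    have hform : ∫ s in (0 : ℝ)..1, ‖G' s v‖ ^ 2 = 0 := by
      have h1 : inner ℝ v (W 1 v) = ∫ s in (0 : ℝ)..1, ‖G' s v‖ ^ 2 := by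
        have h2 := (innerSL ℝ v).intervalIntegral_comp_comm
          (f := fun s => (G s ∘L G' s) v) (μ := volume) (a := 0) (b := 1)
          ((hGG.clm_apply continuous_const).intervalIntegrable _ _)
        rw [hW, ContinuousLinearMap.intervalIntegral_apply (hGG.intervalIntegrable _ _)]
        rw [innerSL_apply_apply] at h2
        rw [← h2]
        congr 1 with s
        simp only [innerSL_apply_apply, ContinuousLinearMap.comp_apply, hG']
        rw [← ContinuousLinearMap.adjoint_inner_left, real_inner_self_eq_norm_sq]
      rw [← h1]
      have : W 1 v = 0 := hv
      rw [this, inner_zero_right]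
    have hzero : ∀ s ∈ Icc (0 : ℝ) 1, G' s v = 0 := by
      intro s hs
      by_contra hne
      have := intervalIntegral.integral_pos (f := fun s => ‖G' s v‖ ^ 2) zero_lt_one
        (by exact ((hGc'.clm_apply continuous_const).norm.pow 2).continuousOn)
        (fun _ _ => by positivity) ⟨s, hs, by positivity⟩
      exact this.ne' hform
    refine eq_zero_of_inner_exp_smul_eq_zero A B hctrl fun s hs w => ?_
    have := ContinuousLinearMap.adjoint_inner_left (G s) w v
    rw [show ContinuousLinearMap.adjoint (G s) v = 0 from hzero s ⟨hs.1.le, hs.2.le⟩,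
      inner_zero_left] at this
    exact this.symm
  obtain ⟨V, hV⟩ : ∃ V : E →L[ℝ] E, W 1 ∘L V = ContinuousLinearMap.id ℝ E := by
    let e := (LinearEquiv.ofInjectiveEndo (W 1 : E →ₗ[ℝ] E)
      (LinearMap.ker_eq_bot.1 hWinj)).toContinuousLinearEquiv
    exact ⟨e.symm, by ext v; exact e.apply_symm_apply v⟩
  set e₁ := NormedSpace.exp ((1 : ℝ) • (-A)) with he₁
  refine ⟨fun t => G' t ∘L (V ∘L e₁), fun t => NormedSpace.exp (t • A) ∘L (W t ∘L (V ∘L e₁)),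
    hGc'.clm_comp continuous_const, ?_, ?_, fun t => ?_⟩
  · simp [hW]
  · dsimp only
    rw [← ContinuousLinearMap.comp_assoc (W 1), hV, ContinuousLinearMap.id_comp]
    exact exp_smul_comp_exp_smul_neg A 1
  · have h := (hasDerivAt_exp_smul_const' A t).clm_comp
      ((hWd t).clm_comp (hasDerivAt_const t (V ∘L e₁)))
    convert h using 1
    have h2 : NormedSpace.exp (t • A) ∘L G t = B := by
      rw [hG, ← ContinuousLinearMap.comp_assoc, exp_smul_comp_exp_smul_neg,
        ContinuousLinearMap.id_comp]
    rw [ContinuousLinearMap.comp_zero, add_zero]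
    congr 1
    nth_rw 1 [← h2]
    simp only [ContinuousLinearMap.comp_assoc]

end Steering

namespace PortHam

namespace LinearOCP

variable {n m : ℕ} {P : LinearOCP n m}

/-! ### Concatenation of trajectories -/

/-- Trajectories can be concatenated, and their costs add up. -/
theorem IsFeasible.append {T₁ T₂ : ℝ} (hT₁ : 0 ≤ T₁) (hT₂ : 0 ≤ T₂)
    {a b c : EuclideanSpace ℝ (Fin n)} {x₁ x₂ : ℝ → EuclideanSpace ℝ (Fin n)}
    {u₁ u₂ : ℝ → EuclideanSpace ℝ (Fin m)}
    (h₁ : P.IsFeasible T₁ a b x₁ u₁) (h₂ : P.IsFeasible T₂ b c x₂ u₂)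
    (hc₁ : P.HasCost T₁ x₁ u₁) (hc₂ : P.HasCost T₂ x₂ u₂) :
    ∃ x u, P.IsFeasible (T₁ + T₂) a c x u ∧ P.HasCost (T₁ + T₂) x u ∧
      P.cost (T₁ + T₂) x u = P.cost T₁ x₁ u₁ + P.cost T₂ x₂ u₂ := by
  obtain ⟨⟨hu₁, hU₁⟩, ⟨hac₁, hd₁⟩, h0₁, hT1⟩ := h₁
  obtain ⟨⟨hu₂, hU₂⟩, ⟨hac₂, hd₂⟩, h0₂, hT2⟩ := h₂
  rw [ae_restrict_iff' measurableSet_Icc] at hU₁ hd₁ hU₂ hd₂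
  have shift : ∀ {p : ℝ → Prop}, (∀ᵐ t, p t) → ∀ᵐ t, p (t - T₁) := fun h =>
    (measurePreserving_sub_right volume T₁).quasiMeasurePreserving.ae h
  have hne : ∀ᵐ t : ℝ, t ≠ T₁ := by simp [ae_iff]
  have hle : T₁ ≤ T₁ + T₂ := by linarith
  set x : ℝ → EuclideanSpace ℝ (Fin n) := fun t => if t ≤ T₁ then x₁ t else x₂ (t - T₁) with hx
  set u : ℝ → EuclideanSpace ℝ (Fin m) := fun t => if t ≤ T₁ then u₁ t else u₂ (t - T₁) with hu
  have hx_le : ∀ {t}, t ≤ T₁ → x t = x₁ t := fun h => if_pos h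
  have hx_gt : ∀ {t}, T₁ < t → x t = x₂ (t - T₁) := fun h => if_neg h.not_ge
  have hu_le : ∀ {t}, t ≤ T₁ → u t = u₁ t := fun h => if_pos h
  have hu_gt : ∀ {t}, T₁ < t → u t = u₂ (t - T₁) := fun h => if_neg h.not_ge
  have left : ∀ {t}, t ∈ uIoc 0 T₁ → t ≤ T₁ := fun h => (uIoc_of_le hT₁ ▸ h).2
  have right : ∀ {t}, t ∈ uIoc T₁ (T₁ + T₂) → T₁ < t := fun h => (uIoc_of_le hle ▸ h).1
  -- the cost on the two pieces
  have hl₁ : EqOn (fun t => P.ℓ (x₁ t) (u₁ t)) (fun t => P.ℓ (x t) (u t)) (uIoc 0 T₁) :=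
    fun t ht => by simp only [hx_le (left ht), hu_le (left ht)]
  have hl₂ : EqOn (fun t => P.ℓ (x₂ (t - T₁)) (u₂ (t - T₁))) (fun t => P.ℓ (x t) (u t))
      (uIoc T₁ (T₁ + T₂)) :=
    fun t ht => by simp only [hx_gt (right ht), hu_gt (right ht)]
  have hi₁ : IntervalIntegrable (fun t => P.ℓ (x t) (u t)) volume 0 T₁ :=
    IntervalIntegrable.congr hl₁ hc₁
  have hi₂ : IntervalIntegrable (fun t => P.ℓ (x t) (u t)) volume T₁ (T₁ + T₂) := by
    refine IntervalIntegrable.congr hl₂ ?_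
    have := IntervalIntegrable.comp_sub_right hc₂ T₁
    rwa [zero_add, add_comm T₂] at this
  refine ⟨x, u, ⟨⟨?_, ?_⟩, ⟨?_, ?_⟩, ?_, ?_⟩, hi₁.trans hi₂, ?_⟩
  · rw [← intervalIntegrable_iff_integrableOn_Icc_of_le (by positivity)]
    rw [← intervalIntegrable_iff_integrableOn_Icc_of_le hT₁] at hu₁
    rw [← intervalIntegrable_iff_integrableOn_Icc_of_le hT₂] at hu₂
    refine (hu₁.congr fun t ht => (hu_le (left ht)).symm).trans
      (IntervalIntegrable.congr (f := fun t => u₂ (t - T₁))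
        (fun t ht => (hu_gt (right ht)).symm) ?_)
    have := hu₂.comp_sub_right T₁
    rwa [zero_add, add_comm T₂] at this
  · rw [ae_restrict_iff' measurableSet_Icc]
    filter_upwards [hU₁, shift hU₂] with t h1 h2 ht
    rcases le_or_gt t T₁ with h | h
    · rw [hu_le h]
      exact h1 ⟨ht.1, h⟩
    · rw [hu_gt h]
      exact h2 ⟨by linarith, by linarith [ht.2]⟩
  · have hform : x = fun t => x₁ (min t T₁) + x₂ (max (t - T₁) 0) - b := by
      funext t
      rcases le_or_gt t T₁ with h | h
      · rw [hx_le h, min_eq_left h, max_eq_right (by linarith), h0₂]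
        abel
      · rw [hx_gt h, min_eq_right h.le, max_eq_left (by linarith), hT1]
        abel
    have hconst : AbsolutelyContinuousOnInterval (fun _ : ℝ => b) 0 (T₁ + T₂) :=
      contDiffOn_const.absolutelyContinuousOnInterval
    rw [hform]
    refine (AbsolutelyContinuousOnInterval.add
      (hac₁.comp_monotone (fun s t h => min_le_min_right _ h)
        (LipschitzWith.id.min_const T₁) ?_)
      (hac₂.comp_monotone (g := fun t => max (t - T₁) 0)
        (fun s t h => max_le_max_right _ (by linarith))
        (LipschitzWith.max_const (LipschitzWith.of_dist_le_mul fun s t => by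
          simp [Real.dist_eq]) 0) ?_)).sub hconst
    · intro t ht
      rw [uIcc_of_le (by positivity)] at ht
      rw [uIcc_of_le hT₁]
      exact ⟨le_min ht.1 hT₁, min_le_right _ _⟩
    · intro t ht
      rw [uIcc_of_le (by positivity)] at ht
      rw [uIcc_of_le hT₂]
      exact ⟨le_max_right _ _, max_le (by linarith [ht.2]) hT₂⟩
  · rw [ae_restrict_iff' measurableSet_Icc]
    filter_upwards [hd₁, shift hd₂, hne] with t h1 h2 htne ht
    rcases lt_or_gt_of_ne htne with h | h
    · rw [hx_le h.le, hu_le h.le]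
      refine (h1 ⟨ht.1, h.le⟩).congr_of_eventuallyEq ?_
      filter_upwards [Iio_mem_nhds h] with s hs using hx_le (le_of_lt hs)
    · rw [hx_gt h, hu_gt h]
      refine ((h2 ⟨by linarith, by linarith [ht.2]⟩).comp_sub_const t T₁).congr_of_eventuallyEq ?_
      filter_upwards [Ioi_mem_nhds h] with s hs using hx_gt hs
  · rw [hx_le hT₁, h0₁]
  · rcases hT₂.eq_or_lt with h | h
    · rw [← h, add_zero, hx_le le_rfl, hT1, ← h0₂, ← hT2, ← h]
    · rw [hx_gt (by linarith), add_sub_cancel_left, hT2]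
  · unfold cost
    rw [← intervalIntegral.integral_add_adjacent_intervals hi₁ hi₂]
    congr 1
    · exact intervalIntegral.integral_congr_ae (.of_forall fun t ht => (hl₁ ht).symm)
    · rw [← intervalIntegral.integral_congr_ae (.of_forall hl₂),
        intervalIntegral.integral_comp_sub_right (fun t => P.ℓ (x₂ t) (u₂ t)), sub_self,
        add_sub_cancel_left]

/-- The state `a` can be steered to `b` in time `T` at cost at most `c`. -/
def Steers (P : LinearOCP n m) (T : ℝ) (a b : EuclideanSpace ℝ (Fin n)) (c : ℝ) : Prop :=
  ∃ x u, P.IsFeasible T a b x u ∧ P.HasCost T x u ∧ P.cost T x u ≤ c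

theorem Steers.trans {T₁ T₂ c₁ c₂ : ℝ} (hT₁ : 0 ≤ T₁) (hT₂ : 0 ≤ T₂)
    {a b c : EuclideanSpace ℝ (Fin n)} (h₁ : P.Steers T₁ a b c₁) (h₂ : P.Steers T₂ b c c₂) :
    P.Steers (T₁ + T₂) a c (c₁ + c₂) := by
  obtain ⟨x₁, u₁, hf₁, hc₁, hle₁⟩ := h₁
  obtain ⟨x₂, u₂, hf₂, hc₂, hle₂⟩ := h₂
  obtain ⟨x, u, hf, hc, hcost⟩ := hf₁.append hT₁ hT₂ hf₂ hc₁ hc₂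
  exact ⟨x, u, hf, hc, hcost.trans_le (add_le_add hle₁ hle₂)⟩

/-- A classical solution with a continuous admissible control and running cost at most `D` in
absolute value steers `x 0` to `x T` at cost at most `D * T`. -/
theorem steers_of_continuous (hℓ : Continuous fun p : EuclideanSpace ℝ (Fin n) ×
      EuclideanSpace ℝ (Fin m) => P.ℓ p.1 p.2) {T D : ℝ} (hT : 0 ≤ T)
    {x : ℝ → EuclideanSpace ℝ (Fin n)} {u : ℝ → EuclideanSpace ℝ (Fin m)}
    (hx : ∀ t, HasDerivAt x (P.A.toEuclideanLin (x t) + P.B.toEuclideanLin (u t)) t)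
    (hu : Continuous u) (hU : ∀ t ∈ Icc 0 T, u t ∈ P.U)
    (hD : ∀ t ∈ Icc 0 T, |P.ℓ (x t) (u t)| ≤ D) : P.Steers T (x 0) (x T) (D * T) := by
  have hxc : Continuous x := continuous_iff_continuousAt.2 fun t => (hx t).continuousAt
  have hxC1 : ContDiff ℝ 1 x := by
    refine contDiff_one_iff_deriv.2 ⟨fun t => (hx t).differentiableAt, ?_⟩
    rw [funext fun t => (hx t).deriv]
    exact (P.A.toEuclideanLin.continuous_of_finiteDimensional.comp hxc).add
      (P.B.toEuclideanLin.continuous_of_finiteDimensional.comp hu)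
  have hcost : Continuous fun t => P.ℓ (x t) (u t) := hℓ.comp (hxc.prodMk hu)
  refine ⟨x, u, ⟨⟨hu.continuousOn.integrableOn_Icc, ae_restrict_of_forall_mem measurableSet_Icc hU⟩,
    ⟨hxC1.contDiffOn.absolutelyContinuousOnInterval, Filter.Eventually.of_forall hx⟩, rfl, rfl⟩,
    hcost.intervalIntegrable _ _, ?_⟩
  have h := intervalIntegral.norm_integral_le_of_norm_le_const (a := 0) (b := T) (C := D)
    (f := fun t => P.ℓ (x t) (u t)) fun t ht => by
      rw [uIoc_of_le hT] at ht
      exact hD t ⟨ht.1.le, ht.2⟩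
  rw [sub_zero, abs_of_nonneg hT] at h
  exact (le_abs_self _).trans h

theorem steers_zero_zero (hℓ : Continuous fun p : EuclideanSpace ℝ (Fin n) ×
      EuclideanSpace ℝ (Fin m) => P.ℓ p.1 p.2) (hℓ0 : P.ℓ 0 0 = 0) (hU : 0 ∈ P.U) {T : ℝ}
    (hT : 0 ≤ T) : P.Steers T 0 0 0 := by
  simpa using steers_of_continuous hℓ (D := 0) hT (x := fun _ => 0) (u := fun _ => 0)
    (fun t => by simpa using hasDerivAt_const t (0 : EuclideanSpace ℝ (Fin n)))
    continuous_const (fun _ _ => hU) (by simp [hℓ0])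

theorem steers_iterate {z : ℕ → EuclideanSpace ℝ (Fin n)} {c : ℝ} {N : ℕ} (hN : 1 ≤ N)
    (h : ∀ k < N, P.Steers 1 (z k) (z (k + 1)) c) : P.Steers N (z 0) (z N) (N * c) := by
  induction N, hN using Nat.le_induction with
  | base => simpa using h 0 one_pos
  | succ k hk ih =>
    have := (ih fun j hj => h j (by omega)).trans (by positivity) zero_le_one (h k (by omega))
    push_cast
    rwa [add_mul, one_mul]

/-! ### Null controllability with small controls -/

/-- Let `(A, B)` be controllable, let `e^{tA}` be bounded for `t ≥ 0`, and let the controls be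
allowed to take all small values.  Then every bounded set of states can be steered to `0` in a
common time and at bounded cost.  In `N` steps of unit length, follow the points
`(1 - k / N) e^{kA} a`: the correction to the free motion in each step is of size `O(1 / N)`, hence
so is the control. -/
theorem exists_steers_zero (hℓ : Continuous fun p : EuclideanSpace ℝ (Fin n) ×
      EuclideanSpace ℝ (Fin m) => P.ℓ p.1 p.2)
    {A : EuclideanSpace ℝ (Fin n) →L[ℝ] EuclideanSpace ℝ (Fin n)}
    {B : EuclideanSpace ℝ (Fin m) →L[ℝ] EuclideanSpace ℝ (Fin n)}
    (hA : ∀ v, A v = P.A.toEuclideanLin v) (hB : ∀ w, B w = P.B.toEuclideanLin w)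
    (hctrl : ∀ v : EuclideanSpace ℝ (Fin n),
      (∀ (k : ℕ) (w : EuclideanSpace ℝ (Fin m)), inner ℝ v ((A ^ k) (B w)) = 0) → v = 0)
    {C : ℝ} (hC : ∀ t : ℝ, 0 ≤ t → ∀ v, ‖NormedSpace.exp (t • A) v‖ ≤ C * ‖v‖)
    {r : ℝ} (hr : 0 < r) (hU : Metric.ball 0 r ⊆ P.U) (ρ : ℝ) :
    ∃ (N : ℕ) (c : ℝ), ∀ a, ‖a‖ ≤ ρ → P.Steers N a 0 c := by
  obtain ⟨U, X, hUc, hX0, hX1, hX⟩ := exists_unit_time_steering A B hctrl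
  have hXc : Continuous X := continuous_iff_continuousAt.2 fun t => (hX t).continuousAt
  obtain ⟨CU, hCU⟩ := isCompact_Icc.exists_bound_of_continuousOn (s := Icc (0 : ℝ) 1)
    hUc.continuousOn
  obtain ⟨CX, hCX⟩ := isCompact_Icc.exists_bound_of_continuousOn (s := Icc (0 : ℝ) 1)
    hXc.continuousOn
  have hCU0 : 0 ≤ CU := (norm_nonneg _).trans (hCU 0 (by norm_num))
  have hCX0 : 0 ≤ CX := (norm_nonneg _).trans (hCX 0 (by norm_num))
  rcases lt_or_ge ρ 0 with hρ | hρ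
  · exact ⟨0, 0, fun a ha => absurd (norm_nonneg a) (by linarith)⟩
  set M : ℝ := |C| * ρ with hM
  have hM0 : 0 ≤ M := by positivity
  obtain ⟨N, hN⟩ := exists_nat_gt (CU * M / r)
  have hNpos : (0 : ℝ) < N := lt_of_le_of_lt (by positivity) hN
  have hN1 : 1 ≤ N := by exact_mod_cast hNpos
  obtain ⟨D, hD⟩ := ((isCompact_closedBall (0 : EuclideanSpace ℝ (Fin n)) (|C| * M + CX * M)).prod
    (isCompact_closedBall (0 : EuclideanSpace ℝ (Fin m)) r)).exists_bound_of_continuousOn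
    hℓ.continuousOn
  refine ⟨N, N * (D * 1), fun a ha => ?_⟩
  set y : ℕ → EuclideanSpace ℝ (Fin n) := fun k => NormedSpace.exp ((k : ℝ) • A) a with hy
  have hyM : ∀ k, ‖y k‖ ≤ M := fun k =>
    (hC k (by positivity) a).trans (mul_le_mul (le_abs_self C) ha (norm_nonneg _) (abs_nonneg _))
  have hysucc : ∀ k, NormedSpace.exp ((1 : ℝ) • A) (y k) = y (k + 1) := by
    intro k
    simp only [hy, Nat.cast_succ]
    rw [add_comm (k : ℝ) 1, exp_add_smul_apply]
  have hsteps := steers_iterate (P := P) (z := fun k => (1 - (k : ℝ) / N) • y k) (c := D * 1)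
    hN1 fun k hk => ?_
  · simpa [hy, hNpos.ne', exp_zero_smul_apply] using hsteps
  set b := (1 / N : ℝ) • y (k + 1) with hb
  have hbM : ‖b‖ ≤ M / N := by
    rw [hb, norm_smul, Real.norm_of_nonneg (by positivity), div_mul_eq_mul_div, one_mul]
    gcongr
    exact hyM _
  have hbM' : ‖b‖ ≤ M := hbM.trans (div_le_self hM0 (by exact_mod_cast hN1))
  set x : ℝ → EuclideanSpace ℝ (Fin n) := fun t =>
    NormedSpace.exp (t • A) ((1 - (k : ℝ) / N) • y k) - X t b with hx
  have hx0 : x 0 = (1 - (k : ℝ) / N) • y k := by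
    simp [hx, hX0, exp_zero_smul_apply]
  have hx1 : x 1 = (1 - ((k + 1 : ℕ) : ℝ) / N) • y (k + 1) := by
    simp only [hx, hX1, map_smul, hysucc, hb, ContinuousLinearMap.id_apply]
    rw [← sub_smul]
    congr 1
    push_cast
    ring
  have huM : ∀ t ∈ Icc (0 : ℝ) 1, ‖-(U t b)‖ < r := by
    intro t ht
    rw [norm_neg]
    calc ‖U t b‖ ≤ CU * (M / N) :=
          ((U t).le_opNorm b).trans (mul_le_mul (hCU t ht) hbM (norm_nonneg _) hCU0)
      _ < r := by
          rw [← mul_div_assoc, div_lt_iff₀ hNpos]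
          rwa [div_lt_iff₀ hr, mul_comm (N : ℝ)] at hN
  rw [← hx0, ← hx1]
  refine steers_of_continuous hℓ zero_le_one (u := fun t => -(U t b)) (fun t => ?_)
    (hUc.clm_apply continuous_const).neg (fun t ht => hU (by simpa using huM t ht))
    fun t ht => hD (x t, -(U t b)) ⟨?_, ?_⟩
  · have h := (hasDerivAt_exp_smul_apply A ((1 - (k : ℝ) / N) • y k) t).sub
      ((hX t).clm_apply (hasDerivAt_const t b))
    refine h.congr_deriv ?_
    rw [← hA, ← hB, map_neg, map_zero, add_zero]
    change A _ - (A (X t b) + B (U t b)) = _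
    simp only [hx, map_sub]
    abel
  · have hk' : (k : ℝ) / N ≤ 1 := (div_le_one hNpos).2 (by exact_mod_cast hk.le)
    have hk0 : 0 ≤ (k : ℝ) / N := by positivity
    have hz : ‖(1 - (k : ℝ) / N) • y k‖ ≤ M := by
      rw [norm_smul, Real.norm_of_nonneg (by linarith)]
      exact (mul_le_of_le_one_left (norm_nonneg _) (by linarith)).trans (hyM k)
    rw [mem_closedBall_zero_iff]
    refine (norm_sub_le _ _).trans (add_le_add ?_ ?_)
    · exact (hC t ht.1 _).trans (mul_le_mul (le_abs_self C) hz (norm_nonneg _) (abs_nonneg _))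
    · exact ((X t).le_opNorm b).trans (mul_le_mul (hCX t ht) hbM' (norm_nonneg _) hCX0)
  · rw [mem_closedBall_zero_iff]
    exact (huM t ht).le

end LinearOCP

/-! ### The Kalman rank condition -/

theorem Controllable.eq_zero_of_inner_eq_zero {n m : ℕ} {A : Matrix (Fin n) (Fin n) ℝ}
    {B : Matrix (Fin n) (Fin m) ℝ} (h : Controllable A B) {v : EuclideanSpace ℝ (Fin n)}
    (hv : ∀ (k : ℕ) (w : EuclideanSpace ℝ (Fin m)),
      inner ℝ v ((A ^ k * B).toEuclideanLin w) = 0) : v = 0 := by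
  have htop : LinearMap.range (kalmanMatrix A B).mulVecLin = ⊤ :=
    Submodule.eq_top_of_finrank_eq (by rw [Module.finrank_fin_fun]; exact h)
  obtain ⟨w, hw⟩ := LinearMap.range_eq_top.1 htop v.ofLp
  have hcol : v.ofLp ᵥ* kalmanMatrix A B = 0 := by
    funext p
    have := hv p.1 (EuclideanSpace.single p.2 1)
    rw [Matrix.toLpLin_apply] at this
    simpa [Matrix.vecMul, dotProduct, PiLp.inner_apply, kalmanMatrix, mul_comm] using this
  have h0 : v.ofLp ⬝ᵥ v.ofLp = 0 := by
    rw [Matrix.mulVecLin_apply] at hw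
    nth_rw 2 [← hw]
    rw [Matrix.dotProduct_mulVec, hcol, zero_dotProduct]
  exact (WithLp.ofLp_eq_zero 2).1 (dotProduct_self_eq_zero.1 h0)

variable {n m : ℕ}

/-! ### The energy of a port-Hamiltonian system -/

theorem inner_toEuclideanLin_left {k : ℕ} (M : Matrix (Fin n) (Fin k) ℝ)
    (v : EuclideanSpace ℝ (Fin k)) (w : EuclideanSpace ℝ (Fin n)) :
    inner ℝ (M.toEuclideanLin v) w = inner ℝ v (Mᵀ.toEuclideanLin w) := by
  have h := Matrix.toEuclideanLin_conjTranspose_eq_adjoint M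
  rw [Matrix.conjTranspose_eq_transpose_of_trivial] at h
  rw [h, LinearMap.adjoint_inner_right]

/-- The quadratic form of a positive semidefinite matrix is the squared norm of its square
root. -/
theorem inner_toEuclideanLin_self_eq_norm_sq {M : Matrix (Fin n) (Fin n) ℝ} (hM : M.PosSemidef)
    (v : EuclideanSpace ℝ (Fin n)) :
    inner ℝ v (M.toEuclideanLin v) = ‖(CFC.sqrt M).toEuclideanLin v‖ ^ 2 := by
  have hs : (CFC.sqrt M)ᵀ = CFC.sqrt M :=
    (Matrix.conjTranspose_eq_transpose_of_trivial _).symm.trans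
      (Matrix.nonneg_iff_posSemidef.1 (CFC.sqrt_nonneg M)).isHermitian
  rw [← real_inner_self_eq_norm_sq, inner_toEuclideanLin_left, hs]
  conv_lhs => rw [← CFC.sqrt_mul_sqrt_self M hM.nonneg]
  rw [Matrix.toLpLin_mul_same, LinearMap.comp_apply]

theorem inner_toEuclideanLin_self_of_skew {J : Matrix (Fin n) (Fin n) ℝ} (hJ : Jᵀ = -J)
    (v : EuclideanSpace ℝ (Fin n)) : inner ℝ v (J.toEuclideanLin v) = 0 := by
  have h := inner_toEuclideanLin_left J v v
  rw [hJ, map_neg, LinearMap.neg_apply, inner_neg_right, real_inner_comm] at h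
  linarith

/-- The energy (Hamiltonian) `x ↦ ½ xᵀ Q x`. -/
noncomputable def energy (Q : Matrix (Fin n) (Fin n) ℝ) (x : EuclideanSpace ℝ (Fin n)) : ℝ :=
  1 / 2 * inner ℝ x (Q.toEuclideanLin x)

theorem contDiff_energy (Q : Matrix (Fin n) (Fin n) ℝ) : ContDiff ℝ 1 (energy Q) :=
  contDiff_const.mul (contDiff_id.inner ℝ
    (LinearMap.toContinuousLinearMap Q.toEuclideanLin).contDiff)

theorem energy_eq_norm_sq {Q : Matrix (Fin n) (Fin n) ℝ} (hQ : Q.PosSemidef)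
    (x : EuclideanSpace ℝ (Fin n)) :
    energy Q x = 1 / 2 * ‖(CFC.sqrt Q).toEuclideanLin x‖ ^ 2 := by
  rw [energy, inner_toEuclideanLin_self_eq_norm_sq hQ]

theorem energy_nonneg {Q : Matrix (Fin n) (Fin n) ℝ} (hQ : Q.PosSemidef)
    (x : EuclideanSpace ℝ (Fin n)) : 0 ≤ energy Q x := by
  rw [energy_eq_norm_sq hQ]
  positivity

theorem hasDerivAt_energy {Q : Matrix (Fin n) (Fin n) ℝ} (hQ : Q.PosSemidef)
    {x : ℝ → EuclideanSpace ℝ (Fin n)} {x' : EuclideanSpace ℝ (Fin n)} {t : ℝ}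
    (hx : HasDerivAt x x' t) :
    HasDerivAt (fun s => energy Q (x s)) (inner ℝ (Q.toEuclideanLin (x t)) x') t := by
  have h := (hx.inner ℝ ((LinearMap.toContinuousLinearMap
    Q.toEuclideanLin).hasFDerivAt.comp_hasDerivAt t hx)).const_mul (1 / 2 : ℝ)
  refine h.congr_deriv ?_
  have hs : Qᵀ = Q :=
    (Matrix.conjTranspose_eq_transpose_of_trivial Q).symm.trans hQ.isHermitian
  have h1 := inner_toEuclideanLin_left Q (x t) x'
  rw [hs] at h1
  have h2 := real_inner_comm x' (Q.toEuclideanLin (x t))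
  simp only [Function.comp_apply, LinearMap.coe_toContinuousLinearMap']
  linarith

/-- Along the free motion the energy is dissipated at the rate `‖R^{1/2} Q x‖²`. -/
theorem inner_drift_eq {J R : Matrix (Fin n) (Fin n) ℝ} (Q : Matrix (Fin n) (Fin n) ℝ)
    (hJ : Jᵀ = -J) (hR : R.PosSemidef) (x : EuclideanSpace ℝ (Fin n)) :
    inner ℝ (Q.toEuclideanLin x) (((J - R) * Q).toEuclideanLin x) =
      -‖(CFC.sqrt R * Q).toEuclideanLin x‖ ^ 2 := by
  rw [Matrix.toLpLin_mul_same, Matrix.toLpLin_mul_same, LinearMap.comp_apply,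
    LinearMap.comp_apply, map_sub, LinearMap.sub_apply, inner_sub_right,
    inner_toEuclideanLin_self_of_skew hJ, inner_toEuclideanLin_self_eq_norm_sq hR, zero_sub]

/-- The drift of a port-Hamiltonian system generates a bounded semigroup, since the energy norm
`‖Q^{1/2} x‖` does not increase along the free motion. -/
theorem exists_norm_exp_smul_le {J R Q : Matrix (Fin n) (Fin n) ℝ}
    (hJ : Jᵀ = -J) (hR : R.PosSemidef) (hQ : Q.PosDef) :
    ∃ C : ℝ, ∀ t : ℝ, 0 ≤ t → ∀ v : EuclideanSpace ℝ (Fin n),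
      ‖NormedSpace.exp (t • LinearMap.toContinuousLinearMap ((J - R) * Q).toEuclideanLin) v‖ ≤
        C * ‖v‖ := by
  set A := LinearMap.toContinuousLinearMap ((J - R) * Q).toEuclideanLin with hA
  set S := (CFC.sqrt Q).toEuclideanLin with hS
  have hker : LinearMap.ker S = ⊥ := by
    rw [LinearMap.ker_eq_bot']
    intro v hv
    have h1 : Q.toEuclideanLin v = 0 := by
      conv_lhs => rw [← CFC.sqrt_mul_sqrt_self Q hQ.posSemidef.nonneg]
      rw [Matrix.toLpLin_mul_same, LinearMap.comp_apply, hv, map_zero]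
    have h2 : Q *ᵥ v.ofLp = Q *ᵥ 0 := by
      rw [Matrix.mulVec_zero]
      exact congrArg WithLp.ofLp h1
    exact (WithLp.ofLp_eq_zero 2).1 (Matrix.mulVec_injective_iff_isUnit.2 hQ.isUnit h2)
  obtain ⟨K, hK, hle⟩ := S.exists_infDist_ker_le
  rw [hker] at hle
  refine ⟨K * ‖LinearMap.toContinuousLinearMap S‖, fun t ht v => ?_⟩
  have hd := fun s => hasDerivAt_energy hQ.posSemidef (hasDerivAt_exp_smul_apply A v s)
  have hanti : Antitone fun s : ℝ => energy Q (NormedSpace.exp (s • A) v) := by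
    refine antitone_of_deriv_nonpos (fun s => (hd s).differentiableAt) fun s => ?_
    rw [(hd s).deriv]
    exact (inner_drift_eq Q hJ hR _).trans_le (neg_nonpos.2 (by positivity))
  have h1 := hanti ht
  simp only [exp_zero_smul_apply, energy_eq_norm_sq hQ.posSemidef] at h1
  have h2 : ‖S (NormedSpace.exp (t • A) v)‖ ≤ ‖S v‖ :=
    le_of_sq_le_sq (by linarith) (norm_nonneg _)
  have h3 := hle (NormedSpace.exp (t • A) v)
  rw [Submodule.bot_coe, Metric.infDist_singleton, dist_zero_right] at h3
  calc _ ≤ K * ‖S (NormedSpace.exp (t • A) v)‖ := h3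
    _ ≤ K * (‖LinearMap.toContinuousLinearMap S‖ * ‖v‖) := by
      gcongr
      exact h2.trans ((LinearMap.toContinuousLinearMap S).le_opNorm v)
    _ = _ := (mul_assoc _ _ _).symm

section OCP

variable {J R Q : Matrix (Fin n) (Fin n) ℝ} {B : Matrix (Fin n) (Fin m) ℝ} {lo hi : Fin m → ℝ}
  {T : ℝ} {x₀ xT : EuclideanSpace ℝ (Fin n)} {x : ℝ → EuclideanSpace ℝ (Fin n)}
  {u : ℝ → EuclideanSpace ℝ (Fin m)}

theorem continuous_supplyRate : Continuous fun p : EuclideanSpace ℝ (Fin n) ×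
    EuclideanSpace ℝ (Fin m) => (energySupplyOCP J R Q B lo hi).ℓ p.1 p.2 :=
  continuous_snd.inner
    ((Bᵀ * Q).toEuclideanLin.continuous_of_finiteDimensional.comp continuous_fst)

/-- The supplied energy is finite along every trajectory, since states are bounded. -/
theorem LinearOCP.IsFeasible.hasCost (hT : 0 ≤ T)
    (h : (energySupplyOCP J R Q B lo hi).IsFeasible T x₀ xT x u) :
    (energySupplyOCP J R Q B lo hi).HasCost T x u := by
  obtain ⟨⟨hu, -⟩, ⟨hac, -⟩, -, -⟩ := h
  have hy : ContinuousOn (fun t => (Bᵀ * Q).toEuclideanLin (x t)) (Icc 0 T) := by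
    have := hac.continuousOn
    rw [uIcc_of_le hT] at this
    exact (Bᵀ * Q).toEuclideanLin.continuous_of_finiteDimensional.comp_continuousOn this
  refine (intervalIntegrable_iff_integrableOn_Icc_of_le hT).2 ?_
  obtain ⟨C, hC⟩ := isCompact_Icc.exists_bound_of_continuousOn hy
  refine (hu.norm.mul_const C).mono'
    (hu.aestronglyMeasurable.inner (hy.aestronglyMeasurable measurableSet_Icc)) ?_
  refine ae_restrict_of_forall_mem measurableSet_Icc fun t ht => ?_
  exact (norm_inner_le_norm _ _).trans (by gcongr; exact hC t ht)

/-- The energy balance: the supplied energy is partly stored and partly dissipated. -/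
theorem energy_balance (hJ : Jᵀ = -J) (hR : R.PosSemidef) (hQ : Q.PosSemidef) (hT : 0 ≤ T)
    (h : (energySupplyOCP J R Q B lo hi).IsFeasible T x₀ xT x u) :
    energy Q xT - energy Q x₀ = ∫ t in (0 : ℝ)..T,
      ((energySupplyOCP J R Q B lo hi).ℓ (x t) (u t) -
        ‖(CFC.sqrt R * Q).toEuclideanLin (x t)‖ ^ 2) := by
  obtain ⟨-, ⟨hac, hd⟩, rfl, rfl⟩ := h
  rw [← ((contDiff_energy Q).comp_absolutelyContinuousOnInterval hac).integral_deriv_eq_sub]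
  rw [ae_restrict_iff' measurableSet_Icc] at hd
  refine intervalIntegral.integral_congr_ae ?_
  filter_upwards [hd] with t hdt ht
  rw [uIoc_of_le hT] at ht
  rw [(hasDerivAt_energy hQ (hdt ⟨ht.1.le, ht.2⟩)).deriv, inner_add_right]
  have h1 : inner ℝ (Q.toEuclideanLin (x t)) (B.toEuclideanLin (u t)) =
      inner ℝ (u t) ((Bᵀ * Q).toEuclideanLin (x t)) := by
    rw [real_inner_comm, inner_toEuclideanLin_left, Matrix.toLpLin_mul_same,
      LinearMap.comp_apply]
  have h2 := inner_drift_eq Q hJ hR (x t)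
  simp only [energySupplyOCP]
  linarith

/-- The dissipation inequality with the energy as storage function holds along all trajectories,
for `α s = (s / K) ^ 2` where `K` bounds the distance to `ker (R^{1/2} Q)` by
`‖R^{1/2} Q x‖`. -/
theorem energy_sub_le (hJ : Jᵀ = -J) (hR : R.PosSemidef) (hQ : Q.PosSemidef) {K : ℝ} (hK : 0 < K)
    (hdist : ∀ z, Metric.infDist z (dissipationKernel R Q : Set (EuclideanSpace ℝ (Fin n))) ≤
      K * ‖(CFC.sqrt R * Q).toEuclideanLin z‖) (hT : 0 ≤ T)
    (h : (energySupplyOCP J R Q B lo hi).IsFeasible T x₀ xT x u) :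
    IntervalIntegrable (fun t => (Metric.infDist (x t)
      (dissipationKernel R Q : Set (EuclideanSpace ℝ (Fin n))) / K) ^ 2) volume 0 T ∧
    energy Q xT - energy Q x₀ ≤ ∫ t in (0 : ℝ)..T, ((energySupplyOCP J R Q B lo hi).ℓ (x t) (u t) -
      (Metric.infDist (x t) (dissipationKernel R Q : Set (EuclideanSpace ℝ (Fin n))) / K) ^ 2) := by
  have hxc : ContinuousOn x (uIcc 0 T) := h.2.1.1.continuousOn
  have hi1 : IntervalIntegrable (fun t => (Metric.infDist (x t)
      (dissipationKernel R Q : Set (EuclideanSpace ℝ (Fin n))) / K) ^ 2) volume 0 T :=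
    ((((Metric.continuous_infDist_pt _).comp_continuousOn hxc).div_const K).pow
      2).intervalIntegrable
  have hi2 : IntervalIntegrable (fun t => ‖(CFC.sqrt R * Q).toEuclideanLin (x t)‖ ^ 2)
      volume 0 T :=
    (((CFC.sqrt R * Q).toEuclideanLin.continuous_of_finiteDimensional.comp_continuousOn
      hxc).norm.pow 2).intervalIntegrable
  have hc : IntervalIntegrable (fun t => (energySupplyOCP J R Q B lo hi).ℓ (x t) (u t))
      volume 0 T := h.hasCost hT
  refine ⟨hi1, ?_⟩
  rw [energy_balance hJ hR hQ hT h]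
  refine intervalIntegral.integral_mono_on hT (hc.sub hi2) (hc.sub hi1) fun t _ => ?_
  have h1 : Metric.infDist (x t) (dissipationKernel R Q : Set (EuclideanSpace ℝ (Fin n))) / K ≤
      ‖(CFC.sqrt R * Q).toEuclideanLin (x t)‖ := (div_le_iff₀' hK).2 (hdist _)
  have h2 := pow_le_pow_left₀ (div_nonneg Metric.infDist_nonneg hK.le) h1 2
  linarith

theorem isClassK_div_sq {K : ℝ} (hK : 0 < K) : IsClassK fun s => (s / K) ^ 2 := by
  refine ⟨by fun_prop, fun a ha b _ hab => ?_, by simp⟩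
  exact pow_lt_pow_left₀ (by gcongr) (div_nonneg ha hK.le) two_ne_zero

/-- Uniformly over a bounded set of initial states and over long horizons, a state reachable from
`0` can be reached at bounded cost: steer to `0`, rest there, and then steer to the target. -/
theorem exists_steers_of_reachable (hJ : Jᵀ = -J) (hR : R.PosSemidef) (hQ : Q.PosDef)
    (hU : (0 : EuclideanSpace ℝ (Fin m)) ∈ interior (controlBox lo hi))
    (hctrl : Controllable ((J - R) * Q) B)
    (hreach : (energySupplyOCP J R Q B lo hi).Reachable 0 xT) (ρ : ℝ) :
    ∃ T₀ c : ℝ, ∀ T, T₀ ≤ T → ∀ a, ‖a‖ ≤ ρ → (energySupplyOCP J R Q B lo hi).Steers T a xT c := by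
  obtain ⟨r, hr, hball⟩ := Metric.mem_nhds_iff.1 (mem_interior_iff_mem_nhds.1 hU)
  obtain ⟨C, hC⟩ := exists_norm_exp_smul_le hJ hR hQ
  obtain ⟨N, c, hN⟩ := LinearOCP.exists_steers_zero (P := energySupplyOCP J R Q B lo hi)
    continuous_supplyRate (A := LinearMap.toContinuousLinearMap ((J - R) * Q).toEuclideanLin)
    (B := LinearMap.toContinuousLinearMap B.toEuclideanLin) (fun _ => rfl) (fun _ => rfl)
    (fun v hv => hctrl.eq_zero_of_inner_eq_zero fun k w => by
      rw [Matrix.toLpLin_mul_same, Matrix.toLpLin_pow]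
      have h := hv k w
      rw [← ContinuousLinearMap.coe_coe, ContinuousLinearMap.toLinearMap_pow] at h
      exact h)
    hC hr hball ρ
  obtain ⟨T₂, hT₂, x₂, u₂, h₂⟩ := hreach
  refine ⟨N + T₂, c + 0 + (energySupplyOCP J R Q B lo hi).cost T₂ x₂ u₂, fun T hT a ha => ?_⟩
  have hrest : (energySupplyOCP J R Q B lo hi).Steers (T - T₂ - N) 0 0 0 :=
    LinearOCP.steers_zero_zero continuous_supplyRate (by simp [energySupplyOCP])
      (interior_subset hU) (by linarith)
  have := ((hN a ha).trans (by positivity) (by linarith) hrest).trans (by linarith) hT₂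
    ⟨x₂, u₂, h₂, h₂.hasCost hT₂, le_rfl⟩
  rwa [show (N : ℝ) + (T - T₂ - N) + T₂ = T by ring] at this

end OCP

end PortHam

/-! ### Strict dissipativity and the subspace turnpike property -/

theorem theorem4 {n m : ℕ} (J R Q : Matrix (Fin n) (Fin n) ℝ) (B : Matrix (Fin n) (Fin m) ℝ)
    (lo hi : Fin m → ℝ) (hJ : Jᵀ = -J) (hR : R.PosSemidef) (hQ : Q.PosDef) (hB : B.rank = m)
    (hU : (0 : EuclideanSpace ℝ (Fin m)) ∈ interior (controlBox lo hi)) :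
    (energySupplyOCP J R Q B lo hi).StrictlyDissipative (dissipationKernel R Q) ∧
    (Controllable ((J - R) * Q) B →
      ∀ xT : EuclideanSpace ℝ (Fin n), (energySupplyOCP J R Q B lo hi).Reachable 0 xT →
        (energySupplyOCP J R Q B lo hi).SubspaceTurnpike xT (dissipationKernel R Q)) := by
  obtain ⟨K, hK, hdist⟩ := (CFC.sqrt R * Q).toEuclideanLin.exists_infDist_ker_le
  refine ⟨⟨energy Q, fun s => (s / K) ^ 2, energy_nonneg hQ.posSemidef, isClassK_div_sq hK,
    fun T x₀ xT x u hT hopt => ?_⟩, fun hctrl xT hreach S hS ε hε => ?_⟩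
  · obtain ⟨hint, hle⟩ := energy_sub_le hJ hR hQ.posSemidef hK hdist hT hopt.1
    have hc : IntervalIntegrable (fun t => (energySupplyOCP J R Q B lo hi).ℓ (x t) (u t))
      volume 0 T := hopt.2.1
    exact ⟨hc.sub hint, hle⟩
  · obtain ⟨ρ, hρ⟩ := hS.isBounded.exists_norm_le
    obtain ⟨T₀, c, hsteer⟩ := exists_steers_of_reachable hJ hR hQ hU hctrl hreach ρ
    obtain ⟨D, hD⟩ := hS.exists_bound_of_continuousOn (contDiff_energy Q).continuous.continuousOn
    have hαε : 0 < (ε / K) ^ 2 := by positivity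
    refine ⟨max 0 (max T₀ ((c + D) / (ε / K) ^ 2)) + 1, by positivity,
      fun T x₀ x u hT hx₀ hopt => ?_⟩
    have hfin : volume {t : ℝ | t ∈ Icc 0 T ∧ ε ≤ Metric.infDist (x t)
        (dissipationKernel R Q : Set (EuclideanSpace ℝ (Fin n)))} ≤ ENNReal.ofReal T := by
      refine (measure_mono fun t ht => ht.1).trans ?_
      rw [Real.volume_Icc, sub_zero]
    rcases lt_or_ge T T₀ with hTlt | hTge
    -- for short horizons, the whole horizon is short enough
    · refine hfin.trans_lt ((ENNReal.ofReal_lt_ofReal_iff (by positivity)).2 ?_)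
      linarith [le_max_right 0 (max T₀ ((c + D) / (ε / K) ^ 2)),
        le_max_left T₀ ((c + D) / (ε / K) ^ 2)]
    obtain ⟨hint, hle⟩ := energy_sub_le hJ hR hQ.posSemidef hK hdist hT hopt.1
    have hc : IntervalIntegrable (fun t => (energySupplyOCP J R Q B lo hi).ℓ (x t) (u t))
      volume 0 T := hopt.2.1
    rw [intervalIntegral.integral_sub hc hint] at hle
    obtain ⟨x', u', hf', hc', hcost'⟩ := hsteer T hTge x₀ (hρ x₀ hx₀)
    have hcost : ∫ t in (0 : ℝ)..T, (energySupplyOCP J R Q B lo hi).ℓ (x t) (u t) ≤ c :=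
      (hopt.2.2 x' u' hf' hc').trans hcost'
    have hE0 : energy Q x₀ ≤ D := (le_abs_self _).trans (hD x₀ hx₀)
    have hET := energy_nonneg hQ.posSemidef xT
    -- Chebyshev's inequality for the dissipated energy
    have hcheb := mul_meas_ge_le_integral_of_nonneg (μ := volume.restrict (Icc 0 T))
      (f := fun t => (Metric.infDist (x t)
        (dissipationKernel R Q : Set (EuclideanSpace ℝ (Fin n))) / K) ^ 2)
      (Filter.Eventually.of_forall fun t => sq_nonneg _)
      ((intervalIntegrable_iff_integrableOn_Icc_of_le hT).1 hint) ((ε / K) ^ 2)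
    rw [integral_Icc_eq_integral_Ioc, ← intervalIntegral.integral_of_le hT] at hcheb
    have hmeas : volume.real {t : ℝ | t ∈ Icc 0 T ∧ ε ≤ Metric.infDist (x t)
        (dissipationKernel R Q : Set (EuclideanSpace ℝ (Fin n)))} ≤ (c + D) / (ε / K) ^ 2 := by
      rw [le_div_iff₀' hαε]
      refine le_trans (mul_le_mul_of_nonneg_left ?_ hαε.le) (hcheb.trans (by linarith))
      rw [Measure.real, Measure.real]
      refine ENNReal.toReal_mono (measure_ne_top _ _) ?_
      rw [Measure.restrict_apply' measurableSet_Icc]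
      refine measure_mono fun t ht => ⟨?_, ht.1⟩
      exact pow_le_pow_left₀ (by positivity) (div_le_div_of_nonneg_right ht.2 hK.le) 2
    rw [← ENNReal.ofReal_toReal (hfin.trans_lt ENNReal.ofReal_lt_top).ne]
    refine (ENNReal.ofReal_lt_ofReal_iff (by positivity)).2 (lt_of_le_of_lt hmeas ?_)
    linarith [le_max_right 0 (max T₀ ((c + D) / (ε / K) ^ 2)),
      le_max_right T₀ ((c + D) / (ε / K) ^ 2)]
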